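/- Let $(G,K)$ be a compact Gelfand pair, i.e. $G$ is a compact Hausdorff topological group with normalised Haar measure, $K$ is a closed subgroup of $G$, and the convolution algebra $L^1(K\backslash G/K)$ of integrable, almost everywhere $K$-bi-invariant complex-valued functions on $G$ is commutative. Let $\mu$ be a finite positive Borel measure on $G$ which is central, i.e. $\mu(gAg^{-1})=\mu(A)$ for all $g\in G$ and all Borel sets $A\subseteq G$. For an irreducible continuous finite-dimensional unitary representation $\pi$ of $G$ on a complex inner product space $V_\pi$, let $\widehat{\mu}(\pi)=\int_G \pi(g^{-1})\,\mu(dg)$. Then for every such $\pi$ there is a unique $c_\pi\in\mathbb{C}$ with $\widehat{\mu}(\pi)=c_\pi I_{V_\pi}$. If, in addition, $\mu$ is $K$-bi-invariant, i.e. $\mu(kA)=\mu(Ak)=\mu(A)$ for all $k\in K$ and all Borel sets $A\subseteq G$, then $c_\pi=0$ for every such $\pi$ with $\dim V_\pi>1$ that is spherical, i.e. for which there is a non-zero $u\in V_\pi$ with $\pi(k)u=u$ for all $k\in K$. -/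

import Mathlib

open MeasureTheory

noncomputable section

namespace GelfandCentral

/-- The Haar measure of a compact group, normalised to have total mass one. -/
def normHaar (G : Type*) [Group G] [TopologicalSpace G] [IsTopologicalGroup G] [CompactSpace G]
    [MeasurableSpace G] [BorelSpace G] : Measure G :=
  Measure.haarMeasure (⊤ : TopologicalSpace.PositiveCompacts G)

/-- Convolution `(f ∗ h)(x) = ∫ f(y) h(y⁻¹ x) dy` of complex functions on a compact group. -/
def conv {G : Type*} [Group G] [TopologicalSpace G] [IsTopologicalGroup G] [CompactSpace G]
    [MeasurableSpace G] [BorelSpace G] (f h : G → ℂ) (x : G) : ℂ :=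
  ∫ y, f y * h (y⁻¹ * x) ∂(normHaar G)

/-- `f` represents an element of `L¹(K \ G / K)`: it is integrable for Haar measure and
almost everywhere invariant under left and right translation by each element of `K`. -/
structure IsL1BiInvariant {G : Type*} [Group G] [TopologicalSpace G] [IsTopologicalGroup G]
    [CompactSpace G] [MeasurableSpace G] [BorelSpace G] (K : Subgroup G) (f : G → ℂ) : Prop where
  integrable : Integrable f (normHaar G)
  left_inv : ∀ k ∈ K, (fun g => f (k * g)) =ᵐ[normHaar G] f
  right_inv : ∀ k ∈ K, (fun g => f (g * k)) =ᵐ[normHaar G] f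

/-- `(G, K)` is a compact Gelfand pair: `K` is a closed subgroup of the compact group `G` and
the convolution algebra `L¹(K \ G / K)` is commutative. -/
structure IsGelfandPair {G : Type*} [Group G] [TopologicalSpace G] [IsTopologicalGroup G]
    [CompactSpace G] [MeasurableSpace G] [BorelSpace G] (K : Subgroup G) : Prop where
  isClosed : IsClosed (K : Set G)
  conv_comm : ∀ f h : G → ℂ, IsL1BiInvariant K f → IsL1BiInvariant K h →
    conv f h =ᵐ[normHaar G] conv h f

/-- `μ(g A g⁻¹) = μ(A)` for all `g` in `G` and all Borel sets `A`. -/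
def IsCentral {G : Type*} [Group G] [MeasurableSpace G] (μ : Measure G) : Prop :=
  ∀ (g : G) (A : Set G), MeasurableSet A → μ ((fun x => g * x * g⁻¹) '' A) = μ A

/-- `μ(k A) = μ(A) = μ(A k)` for all `k` in `K` and all Borel sets `A`. -/
def IsBiInvariant {G : Type*} [Group G] [MeasurableSpace G] (K : Subgroup G) (μ : Measure G) :
    Prop :=
  ∀ k ∈ K, ∀ A : Set G, MeasurableSet A →
    μ ((fun x => k * x) '' A) = μ A ∧ μ ((fun x => x * k) '' A) = μ A

/-- The linear representation underlying an action by unitary operators. -/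
def toRep {G V : Type*} [Group G] [NormedAddCommGroup V] [InnerProductSpace ℂ V]
    (ρ : G →* (V ≃ₗᵢ[ℂ] V)) : Representation ℂ G V where
  toFun g := ((ρ g).toLinearEquiv : V →ₗ[ℂ] V)
  map_one' := by ext v; simp
  map_mul' g h := by ext v; simp

/-- A continuous irreducible unitary representation of `G` on `V`. -/
structure UnitaryIrrep (G V : Type*) [Group G] [TopologicalSpace G]
    [NormedAddCommGroup V] [InnerProductSpace ℂ V] where
  /-- the homomorphism into the group of unitary operators on `V` -/
  hom : G →* (V ≃ₗᵢ[ℂ] V)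
  continuous_apply : ∀ v : V, Continuous fun g => hom g v
  irreducible : (toRep hom).IsIrreducible

/-- The operator `π(g)` on `V`. -/
def UnitaryIrrep.op {G V : Type*} [Group G] [TopologicalSpace G]
    [NormedAddCommGroup V] [InnerProductSpace ℂ V] (π : UnitaryIrrep G V) (g : G) : V →L[ℂ] V :=
  ((π.hom g).toContinuousLinearEquiv : V →L[ℂ] V)

/-- `π` is spherical with respect to `K`: there is a non-zero vector fixed by `π(k)`, `k ∈ K`. -/
def UnitaryIrrep.IsSpherical {G V : Type*} [Group G] [TopologicalSpace G]
    [NormedAddCommGroup V] [InnerProductSpace ℂ V] (π : UnitaryIrrep G V) (K : Subgroup G) :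
    Prop :=
  ∃ u : V, u ≠ 0 ∧ ∀ k ∈ K, π.op k u = u

/-- The Fourier transform `∫ π(g⁻¹) μ(dg)` of a measure, an operator on the representation
space. -/
def fourier {G V : Type*} [Group G] [TopologicalSpace G] [MeasurableSpace G]
    [NormedAddCommGroup V] [InnerProductSpace ℂ V] (μ : Measure G) (π : UnitaryIrrep G V) :
    V →L[ℂ] V :=
  ∫ g, π.op g⁻¹ ∂μ

end GelfandCentral

end

open MeasureTheory

namespace GelfandCentral

section Representation

variable {G V : Type*} [Group G] [TopologicalSpace G] [NormedAddCommGroup V]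
  [InnerProductSpace ℂ V]

/-! Centrality of `μ` makes its Fourier transform commute with every `π(h)`, so by Schur's lemma it
is a scalar `c`. If `μ` is also `K`-bi-invariant, then `c π(k) = c` for `k ∈ K`, so `c ≠ 0` forces
`π` to be trivial on `K`. All matrix coefficients of `π` are then `K`-bi-invariant, and by Schur
orthogonality they convolve like matrix units, which do not commute when `dim V > 1`. This
contradicts the Gelfand property (`IsGelfandPair.finrank_le_one`). -/

theorem UnitaryIrrep.op_one (π : UnitaryIrrep G V) : π.op 1 = 1 := by
  ext v
  simp [UnitaryIrrep.op]

theorem UnitaryIrrep.op_mul (π : UnitaryIrrep G V) (g h : G) :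
    π.op (g * h) = π.op g * π.op h := by
  ext v
  simp [UnitaryIrrep.op]

theorem UnitaryIrrep.op_inv_mul_op (π : UnitaryIrrep G V) (g : G) :
    π.op g⁻¹ * π.op g = 1 := by
  rw [← π.op_mul, inv_mul_cancel, π.op_one]

theorem UnitaryIrrep.continuous_op [FiniteDimensional ℂ V] (π : UnitaryIrrep G V) :
    Continuous π.op :=
  continuous_clm_apply.2 π.continuous_apply

theorem UnitaryIrrep.nontrivial (π : UnitaryIrrep G V) : Nontrivial V := by
  by_contra h
  rw [not_nontrivial_iff_subsingleton] at h
  have := π.irreducible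
  obtain ⟨x, y, hxy⟩ := exists_pair_ne (Subrepresentation (toRep π.hom))
  exact hxy (Subrepresentation.toSubmodule_injective (Subsingleton.elim _ _))

theorem UnitaryIrrep.continuous_op_mul_op_inv [IsTopologicalGroup G] [FiniteDimensional ℂ V]
    (π : UnitaryIrrep G V) (X : V →L[ℂ] V) :
    Continuous fun g => π.op g * X * π.op g⁻¹ :=
  (π.continuous_op.mul continuous_const).mul (π.continuous_op.comp continuous_inv)

/-- Schur's lemma. -/
theorem UnitaryIrrep.exists_eq_smul_one [FiniteDimensional ℂ V] (π : UnitaryIrrep G V)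
    (T : V →L[ℂ] V) (hT : ∀ g, π.op g * T = T * π.op g) : ∃ c : ℂ, T = c • 1 := by
  have := π.irreducible
  obtain ⟨c, hc⟩ :=
    (Representation.IsIrreducible.algebraMap_intertwiningMap_bijective_of_isAlgClosed
      (ρ := toRep π.hom)).2
      ⟨T.toLinearMap, fun g => LinearMap.ext fun v => (congrArg (fun S => S v) (hT g)).symm⟩
  refine ⟨c, ContinuousLinearMap.ext fun v => ?_⟩
  exact (congrArg (fun S => S v) hc).symm

/-- In an irreducible representation every orbit of a non-zero vector is total. -/
theorem UnitaryIrrep.eq_zero_of_inner_op_eq_zero (π : UnitaryIrrep G V) {a d : V} (hd : d ≠ 0)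
    (h : ∀ g, inner ℂ a (π.op g d) = 0) : a = 0 := by
  have := π.irreducible
  let W : Subrepresentation (toRep π.hom) :=
    { toSubmodule := Submodule.span ℂ (Set.range fun g => π.op g d)
      apply_mem_toSubmodule := fun g v hv => by
        induction hv using Submodule.span_induction with
        | mem x hx =>
          obtain ⟨k, rfl⟩ := hx
          refine Submodule.subset_span ⟨g * k, ?_⟩
          exact congrArg (fun S => S d) (π.op_mul g k)
        | zero => simp
        | add x y _ _ hx hy => rw [map_add]; exact add_mem hx hy
        | smul c x _ hx => rw [map_smul]; exact Submodule.smul_mem _ _ hx }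
  have hdW : d ∈ W.toSubmodule := Submodule.subset_span ⟨1, by simp [π.op_one]⟩
  have haW : a ∈ W.toSubmodule := by
    rcases eq_bot_or_eq_top W with hW | hW
    · rw [hW] at hdW
      exact absurd hdW hd
    · rw [hW]
      trivial
  have hle : W.toSubmodule ≤ LinearMap.ker (innerSL ℂ a).toLinearMap :=
    Submodule.span_le.2 (by rintro _ ⟨g, rfl⟩; exact h g)
  exact inner_self_eq_zero.1 (hle haW)

end Representation

/-- A homeomorphism is a measurable equivalence, so invariance under images is measure preservation,
and `F` needs no regularity. -/
theorem integral_comp_homeomorph_eq {X E : Type*} [TopologicalSpace X] [MeasurableSpace X]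
    [BorelSpace X] [NormedAddCommGroup E] [NormedSpace ℝ E] {μ : Measure X} (e : X ≃ₜ X)
    (he : ∀ A, MeasurableSet A → μ (e '' A) = μ A) (F : X → E) :
    ∫ x, F (e x) ∂μ = ∫ x, F x ∂μ := by
  have hp : MeasurePreserving e.toMeasurableEquiv μ μ := by
    refine ⟨e.toMeasurableEquiv.measurable, Measure.ext fun A hA => ?_⟩
    rw [Measure.map_apply e.toMeasurableEquiv.measurable hA,
      ← he _ (e.toMeasurableEquiv.measurable hA)]
    congr 1
    exact Set.image_preimage_eq A e.surjective
  exact hp.integral_comp' F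

theorem integrable_of_continuous_of_compactSpace {X E : Type*} [TopologicalSpace X]
    [CompactSpace X] [MeasurableSpace X] [BorelSpace X] [NormedAddCommGroup E] {μ : Measure X}
    [IsFiniteMeasureOnCompacts μ] {F : X → E} (hF : Continuous F) : Integrable F μ :=
  hF.integrable_of_hasCompactSupport (HasCompactSupport.of_compactSpace F)

section Compact

variable {G V : Type*} [Group G] [TopologicalSpace G] [IsTopologicalGroup G] [CompactSpace G]
  [MeasurableSpace G] [BorelSpace G] [NormedAddCommGroup V] [InnerProductSpace ℂ V]
  [FiniteDimensional ℂ V]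

theorem integrable_op_inv (μ : Measure G) [IsFiniteMeasure μ] (π : UnitaryIrrep G V) :
    Integrable (fun g => π.op g⁻¹) μ :=
  integrable_of_continuous_of_compactSpace (π.continuous_op.comp continuous_inv)

theorem IsCentral.op_mul_fourier {μ : Measure G} [IsFiniteMeasure μ] (hμ : IsCentral μ)
    (π : UnitaryIrrep G V) (h : G) : π.op h * fourier μ π = fourier μ π * π.op h := by
  have hint := integrable_op_inv μ π
  have hconj := integral_comp_homeomorph_eq
    ((Homeomorph.mulLeft h).trans (Homeomorph.mulRight h⁻¹)) (hμ h) fun g => π.op g⁻¹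
  have hpt (x : G) : π.op (h * x * h⁻¹)⁻¹ * π.op h = π.op h * π.op x⁻¹ := by
    rw [← π.op_mul, ← π.op_mul]
    congr 1
    group
  unfold fourier
  rw [← integral_const_mul_of_integrable hint]
  simp_rw [← hpt]
  rw [integral_mul_const_of_integrable]
  · exact congrArg (· * π.op h) hconj
  · exact integrable_of_continuous_of_compactSpace (π.continuous_op.comp (by fun_prop))

theorem IsBiInvariant.fourier_mul_op {K : Subgroup G} {μ : Measure G} [IsFiniteMeasure μ]
    (hμ : IsBiInvariant K μ) (π : UnitaryIrrep G V) {k : G} (hk : k ∈ K) :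
    fourier μ π * π.op k = fourier μ π := by
  -- Translating by `k⁻¹` produces the right factor: `π((k⁻¹x)⁻¹) = π(x⁻¹) π(k)`.
  have hinv := integral_comp_homeomorph_eq (Homeomorph.mulLeft k⁻¹)
    (fun A hA => (hμ k⁻¹ (K.inv_mem hk) A hA).1) fun g => π.op g⁻¹
  unfold fourier
  rw [← integral_mul_const_of_integrable (integrable_op_inv μ π), ← hinv]
  refine integral_congr_ae (.of_forall fun x => ?_)
  simp [← π.op_mul]

instance isHaarMeasure_normHaar : (normHaar G).IsHaarMeasure :=
  Measure.isHaarMeasure_haarMeasure _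

instance isProbabilityMeasure_normHaar : IsProbabilityMeasure (normHaar G) :=
  ⟨Measure.haarMeasure_self (K₀ := (⊤ : TopologicalSpace.PositiveCompacts G))⟩

/-- The average of an operator over the conjugates by an irreducible representation is scalar. -/
theorem exists_integral_op_mul_op_inv_eq (π : UnitaryIrrep G V) (X : V →L[ℂ] V) :
    ∃ s : ℂ, ∫ g, π.op g * X * π.op g⁻¹ ∂(normHaar G) = s • 1 ∧
      s * Module.finrank ℂ V = LinearMap.trace ℂ V X.toLinearMap := by
  have hcont := π.continuous_op_mul_op_inv X
  have hint : Integrable (fun g => π.op g * X * π.op g⁻¹) (normHaar G) :=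
    integrable_of_continuous_of_compactSpace hcont
  obtain ⟨s, hs⟩ := π.exists_eq_smul_one (∫ g, π.op g * X * π.op g⁻¹ ∂(normHaar G)) fun h => by
    have hinv := integral_mul_left_eq_self (μ := normHaar G)
      (fun g => π.op g * X * π.op g⁻¹) h
    have hpt (g : G) : π.op (h * g) * X * π.op (h * g)⁻¹ * π.op h
        = π.op h * (π.op g * X * π.op g⁻¹) := by
      rw [mul_assoc, ← π.op_mul, mul_inv_rev, inv_mul_cancel_right, π.op_mul]
      simp only [mul_assoc]
    rw [← integral_const_mul_of_integrable hint]
    simp_rw [← hpt]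
    rw [integral_mul_const_of_integrable, hinv]
    exact integrable_of_continuous_of_compactSpace (hcont.comp (continuous_const_mul h))
  refine ⟨s, hs, ?_⟩
  let tr : (V →L[ℂ] V) →L[ℂ] ℂ :=
    (LinearMap.trace ℂ V ∘ₗ ContinuousLinearMap.coeLM ℂ).toContinuousLinearMap
  have htr (T : V →L[ℂ] V) : tr T = LinearMap.trace ℂ V T.toLinearMap := rfl
  -- The trace is conjugation invariant and the Haar measure has mass one, so the average has the
  -- trace of `X`.
  have hpt (g : G) : tr (π.op g * X * π.op g⁻¹) = tr X := by
    have hcyc : tr (π.op g * X * π.op g⁻¹) = tr (π.op g⁻¹ * (π.op g * X)) :=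
      LinearMap.trace_mul_comm ℂ (π.op g * X).toLinearMap (π.op g⁻¹).toLinearMap
    rw [hcyc, ← mul_assoc, π.op_inv_mul_op, one_mul]
  have hcomm := tr.integral_comp_comm hint
  simp_rw [hpt] at hcomm
  rw [hs, integral_const, map_smul, htr, htr, ContinuousLinearMap.toLinearMap_one,
    LinearMap.trace_one] at hcomm
  simpa using hcomm.symm

/-- Schur orthogonality, as a formula for the convolution of matrix coefficients. -/
theorem exists_conv_inner_op_eq (π : UnitaryIrrep G V) (b c : V) :
    ∃ s : ℂ, s * Module.finrank ℂ V = inner ℂ c b ∧ ∀ a d x,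
      conv (fun g => inner ℂ a (π.op g b)) (fun g => inner ℂ c (π.op g d)) x
        = s * inner ℂ a (π.op x d) := by
  obtain ⟨s, hs, htr⟩ := exists_integral_op_mul_op_inv_eq π (InnerProductSpace.rankOne ℂ b c)
  refine ⟨s, by rw [htr, InnerProductSpace.trace_rankOne], fun a d x => ?_⟩
  -- With `X = b⟨c, ·⟩`, applying `L` to `π(y) X π(y⁻¹)` gives `⟨a, π(y)b⟩⟨c, π(y⁻¹x)d⟩`, the
  -- convolution integrand.
  let L : (V →L[ℂ] V) →L[ℂ] ℂ := (innerSL ℂ a).comp (ContinuousLinearMap.apply ℂ V (π.op x d))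
  have hcomm := L.integral_comp_comm
    (integrable_of_continuous_of_compactSpace (μ := normHaar G)
      (π.continuous_op_mul_op_inv (InnerProductSpace.rankOne ℂ b c)))
  rw [hs] at hcomm
  have hL : L (s • 1) = s * inner ℂ a (π.op x d) := by simp [L]
  rw [← hL, ← hcomm, conv]
  refine integral_congr_ae (.of_forall fun y => ?_)
  simp [L, π.op_mul, mul_comm]

omit [FiniteDimensional ℂ V] in
theorem isL1BiInvariant_inner_op {K : Subgroup G} (π : UnitaryIrrep G V)
    (hπ : ∀ k ∈ K, π.op k = 1) (a b : V) :
    IsL1BiInvariant K fun g => inner ℂ a (π.op g b) where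
  integrable := integrable_of_continuous_of_compactSpace
    (continuous_const.inner (π.continuous_apply b))
  left_inv k hk := .of_forall fun g => by simp [π.op_mul, hπ k hk]
  right_inv k hk := .of_forall fun g => by simp [π.op_mul, hπ k hk]

/-- An irreducible representation of a Gelfand pair which is trivial on the subgroup is
one-dimensional. -/
theorem IsGelfandPair.finrank_le_one {K : Subgroup G} (hK : IsGelfandPair K)
    (π : UnitaryIrrep G V) (hπ : ∀ k ∈ K, π.op k = 1) : Module.finrank ℂ V ≤ 1 := by
  by_contra! hn
  have := π.nontrivial
  obtain ⟨d, hd⟩ := exists_ne (0 : V)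
  obtain ⟨a, ha, hda⟩ : ∃ a : V, a ≠ 0 ∧ inner ℂ d a = 0 := by
    by_contra! h
    have hker : LinearMap.ker (innerSL ℂ d).toLinearMap = ⊥ :=
      (Submodule.eq_bot_iff _).2 fun a ha => by
        by_contra hne
        exact h a hne ha
    have hle := LinearMap.finrank_le_finrank_of_injective (LinearMap.ker_eq_bot.1 hker)
    rw [Module.finrank_self] at hle
    omega
  obtain ⟨s, hs, hconv⟩ := exists_conv_inner_op_eq π d d
  obtain ⟨t, ht, hconv'⟩ := exists_conv_inner_op_eq π d a
  have hs0 : s ≠ 0 := by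
    rintro rfl
    rw [zero_mul] at hs
    exact hd (inner_self_eq_zero.1 hs.symm)
  have had : inner ℂ a d = (0 : ℂ) := inner_eq_zero_symm.1 hda
  have ht0 : t = 0 := by
    rw [had] at ht
    exact (mul_eq_zero.1 ht).resolve_right (by norm_cast; omega)
  have hae := hK.conv_comm _ _ (isL1BiInvariant_inner_op π hπ a d)
    (isL1BiInvariant_inner_op π hπ d d)
  have hcont : Continuous fun x => inner ℂ a (π.op x d) :=
    continuous_const.inner (π.continuous_apply d)
  -- One order of convolution gives `s⟨a, π(x)d⟩`, the other zero because `a ⟂ d`. Both sides are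
  -- continuous, so almost everywhere equality holds everywhere.
  have hzero : (fun x => s * inner ℂ a (π.op x d)) = fun _ => 0 := by
    refine (Continuous.ae_eq_iff_eq (normHaar G) (continuous_const.mul hcont)
      continuous_const).1 ?_
    filter_upwards [hae] with x hx
    rw [hconv, hconv', ht0, zero_mul] at hx
    exact hx
  exact ha (π.eq_zero_of_inner_op_eq_zero hd fun g =>
    (mul_eq_zero.1 (congrFun hzero g)).resolve_left hs0)

end Compact

end GelfandCentral


theorem proposition4p2 {G : Type*} [Group G] [TopologicalSpace G] [IsTopologicalGroup G]
    [CompactSpace G] [T2Space G] [MeasurableSpace G] [BorelSpace G]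
    (K : Subgroup G) (hK : GelfandCentral.IsGelfandPair K)
    (μ : MeasureTheory.Measure G) [MeasureTheory.IsFiniteMeasure μ]
    (hμ : GelfandCentral.IsCentral μ)
    {V : Type*} [NormedAddCommGroup V] [InnerProductSpace ℂ V] [FiniteDimensional ℂ V]
    (π : GelfandCentral.UnitaryIrrep G V) :
    ∃ c : ℂ,
      (∀ c' : ℂ, GelfandCentral.fourier μ π = c' • ContinuousLinearMap.id ℂ V ↔ c' = c) ∧
      (GelfandCentral.IsBiInvariant K μ → π.IsSpherical K → 1 < Module.finrank ℂ V → c = 0) := by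
  have := π.nontrivial
  obtain ⟨c, hc⟩ := π.exists_eq_smul_one (GelfandCentral.fourier μ π) (hμ.op_mul_fourier π)
  refine ⟨c, fun c' => ?_, fun hbi _ hdim => ?_⟩
  · rw [hc]
    exact ⟨fun h => (smul_left_injective ℂ (one_ne_zero (α := V →L[ℂ] V)) h).symm,
      fun h => h ▸ rfl⟩
  · by_contra hc0
    refine absurd (hK.finrank_le_one π fun k hk => ?_) (not_le.2 hdim)
    have h := hbi.fourier_mul_op π hk
    rw [hc, smul_mul_assoc, one_mul] at h
    exact smul_right_injective _ hc0 h
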